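/- Let $1\le k\le n$ be integers. The enhanced hypercube $Q_{n,k}$ is the simple graph whose vertices are the binary strings $u_nu_{n-1}\cdots u_1$ of length $n$, in which two distinct vertices are adjacent if and only if either they differ in exactly one bit, or they are complementary in the bits $1,\dots,k$ and agree in the bits $k+1,\dots,n$. For $1\le i\le n$ let $E_i$ be the set of edges whose two ends differ exactly in the $i$-th bit. Then: 1. If $n\ge 3$, every edge of $Q_{n,k}$ lies on a cycle of every even length from $4$ to $2^n$. 2. If $k$ is even, then (a) every edge of $Q_{n,k}$ lies on a cycle of every odd length from $k+3$ to $2^n-1$; (b) every edge of $Q_{n,k}$ that belongs to none of the sets $E_i$ with $k+1\le i\le n$ also lies on a cycle of length $k+1$; (c) every odd cycle of $Q_{n,k}$ has length at least $k+1$, so that $k+1$ is the length of a shortest odd cycle of $Q_{n,k}$. -/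

import Mathlib

/-- The `n`-dimensional hypercube on the binary strings of length `n`: two strings are adjacent
iff they differ in exactly one bit. The bits, numbered `1, …, n` in print, are indexed here by
`Fin n`, so that the `i`-th bit is the coordinate with value `i - 1`. -/
def hypercubeGraph (n : ℕ) : SimpleGraph (Fin n → Bool) where
  Adj u v := ∃! i : Fin n, u i ≠ v i
  symm := ⟨fun _ _ ⟨i, hi, huniq⟩ => ⟨i, hi.symm, fun j hj => huniq j (Ne.symm hj)⟩⟩
  loopless := ⟨fun _ ⟨_, hi, _⟩ => hi rfl⟩

/-- The graph of the skips: two distinct strings are adjacent iff they are complementary in the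
first `k` bits and agree in all other bits. -/
def skipGraph (n k : ℕ) : SimpleGraph (Fin n → Bool) where
  Adj u v := u ≠ v ∧ ∀ i : Fin n, u i ≠ v i ↔ i.val < k
  symm := ⟨fun _ _ h => ⟨h.1.symm, fun i => ne_comm.trans (h.2 i)⟩⟩
  loopless := ⟨fun _ h => h.1 rfl⟩

/-- The enhanced hypercube `Q_{n,k}`: the hypercube together with the skips. -/
def enhancedHypercube (n k : ℕ) : SimpleGraph (Fin n → Bool) :=
  hypercubeGraph n ⊔ skipGraph n k

/-- The set of hypercube edges whose two ends differ exactly in the bit `i`. -/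
def dimensionEdges (n : ℕ) (i : Fin n) : Set (Sym2 (Fin n → Bool)) :=
  {e | ∃ u : Fin n → Bool, e = s(u, Function.update u i (!u i))}

/-- The edge `e` lies on a cycle of length `l` in `G`. -/
def LiesOnCycleOfLength {V : Type*} (G : SimpleGraph V) (e : Sym2 V) (l : ℕ) : Prop :=
  ∃ (u : V) (p : G.Walk u u), p.IsCycle ∧ p.length = l ∧ e ∈ p.edges

open SimpleGraph

/-! Everything reduces to bipanconnectedness of the ordinary hypercube (`hypercubeBipanconnected`),
proved by induction on opposite faces: a hypercube edge closes an odd path into an even cycle, and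
for even `k` a skip, whose ends are at Hamming distance `k`, closes an even path into an odd cycle.
The involution `skipSwap` exchanges skips with edges in a bit below `k`, so each of these two kinds
inherits the cycles of the other. Edges in a higher bit get odd cycles from a path that avoids one
vertex (`exists_isPath_of_flip`). The bound on odd cycles is a parity count of flips per bit. -/

theorem hypercubeGraph_adj_insertNth {n : ℕ} (i : Fin (n + 1)) (p : Bool) {a b : Fin n → Bool}
    (h : (hypercubeGraph n).Adj a b) :
    (hypercubeGraph (n + 1)).Adj (i.insertNth p a) (i.insertNth p b) := by
  obtain ⟨j, hj, huniq⟩ := h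
  refine ⟨i.succAbove j, by simpa using hj, fun m hm => ?_⟩
  induction m using Fin.succAboveCases i with
  | x => simp at hm
  | p m => rw [huniq m (by simpa using hm)]

theorem hypercubeGraph_adj_insertNth_not {n : ℕ} (i : Fin (n + 1)) (p : Bool) (a : Fin n → Bool) :
    (hypercubeGraph (n + 1)).Adj (i.insertNth p a) (i.insertNth (!p) a) := by
  refine ⟨i, by simp, fun m hm => ?_⟩
  induction m using Fin.succAboveCases i with
  | x => rfl
  | p m => simp at hm

theorem hypercubeGraph_adj_update {n : ℕ} (u : Fin n → Bool) (i : Fin n) :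
    (hypercubeGraph n).Adj u (Function.update u i (!u i)) := by
  refine ⟨i, by simp, fun j hj => ?_⟩
  by_contra h
  simp [Function.update_of_ne h] at hj

/-- The inclusion of the face of the hypercube on which the bit `i` equals `p`. -/
def hypercubeFace {n : ℕ} (i : Fin (n + 1)) (p : Bool) :
    hypercubeGraph n →g hypercubeGraph (n + 1) where
  toFun a := i.insertNth p a
  map_rel' h := hypercubeGraph_adj_insertNth i p h

theorem hypercubeFace_injective {n : ℕ} (i : Fin (n + 1)) (p : Bool) :
    Function.Injective (hypercubeFace i p) :=
  Fin.insertNth_right_injective (α := fun _ => Bool) p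

theorem hammingDist_insertNth {n : ℕ} (i : Fin (n + 1)) (p q : Bool) (a b : Fin n → Bool) :
    hammingDist (i.insertNth p a : Fin (n + 1) → Bool) (i.insertNth q b) =
      (if p ≠ q then 1 else 0) + hammingDist a b := by
  simp only [hammingDist, Finset.card_filter]
  rw [Fin.sum_univ_succAbove _ i]
  simp

theorem hammingDist_mod_two {n : ℕ} (a b c : Fin n → Bool) :
    hammingDist a c % 2 = (hammingDist a b + hammingDist b c) % 2 := by
  simp only [hammingDist, Finset.card_filter, ← Finset.sum_add_distrib]
  rw [Finset.sum_nat_mod]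
  conv_rhs => rw [Finset.sum_nat_mod]
  refine congrArg (· % 2) (Finset.sum_congr rfl fun i _ => ?_)
  cases a i <;> cases b i <;> cases c i <;> rfl

theorem hammingDist_eq_one_of_adj {n : ℕ} {a b : Fin n → Bool}
    (h : (hypercubeGraph n).Adj a b) : hammingDist a b = 1 := by
  obtain ⟨i, hi, huniq⟩ := h
  rw [hammingDist, Finset.card_eq_one]
  exact ⟨i, by ext j; simp only [Finset.mem_filter, Finset.mem_univ, true_and,
    Finset.mem_singleton]; exact ⟨huniq j, fun h => h ▸ hi⟩⟩

theorem hammingDist_le {n : ℕ} (a b : Fin n → Bool) : hammingDist a b ≤ n := by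
  simpa using hammingDist_le_card_fintype (x := a) (y := b)

theorem exists_adj_ne {n : ℕ} (hn : 2 ≤ n) (a b : Fin n → Bool) :
    ∃ c, (hypercubeGraph n).Adj c b ∧ a ≠ c := by
  let i : Fin n := ⟨0, by omega⟩
  let j : Fin n := ⟨1, by omega⟩
  have hij : i ≠ j := by simp [i, j]
  by_cases h : a = Function.update b i (!b i)
  · refine ⟨_, (hypercubeGraph_adj_update b j).symm, fun h' => ?_⟩
    have := congrFun (h.symm.trans h') i
    simp [Function.update_of_ne hij] at this
  · exact ⟨_, (hypercubeGraph_adj_update b i).symm, h⟩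

/-! ### Bipanconnectedness of the hypercube -/

/-- Two paths in opposite faces of the hypercube are joined by an edge into one path. -/
theorem exists_isPath_across {n : ℕ} (i : Fin (n + 1)) (p : Bool) {a b c : Fin n → Bool}
    {P : (hypercubeGraph n).Walk a c} {Q : (hypercubeGraph n).Walk c b}
    (hP : P.IsPath) (hQ : Q.IsPath) :
    ∃ R : (hypercubeGraph (n + 1)).Walk (hypercubeFace i p a) (hypercubeFace i (!p) b),
      R.IsPath ∧ R.length = P.length + 1 + Q.length ∧
        ∀ x, hypercubeFace i (!p) x ∈ R.support → x ∈ Q.support := by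
  have hc : (hypercubeGraph (n + 1)).Adj (hypercubeFace i p c) (hypercubeFace i (!p) c) :=
    hypercubeGraph_adj_insertNth_not i p c
  let R := (P.map (hypercubeFace i p)).append (Walk.cons hc (Q.map (hypercubeFace i (!p))))
  have hR : R.support = P.support.map (hypercubeFace i p) ++
      Q.support.map (hypercubeFace i (!p)) := by
    simp [R, Walk.support_append]
  refine ⟨R, Walk.IsPath.mk' ?_, ?_, fun x hx => ?_⟩
  · rw [hR]
    refine List.Nodup.append (hP.support_nodup.map (hypercubeFace_injective i p))
      (hQ.support_nodup.map (hypercubeFace_injective i (!p))) ?_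
    intro x hx hy
    obtain ⟨y, -, rfl⟩ := List.mem_map.1 hx
    obtain ⟨z, -, hz⟩ := List.mem_map.1 hy
    have := congrFun hz i
    simp [hypercubeFace] at this
  · simp [R]; omega
  · rw [hR, List.mem_append] at hx
    rcases hx with hx | hx
    · obtain ⟨y, -, hy⟩ := List.mem_map.1 hx
      have := congrFun hy i
      simp [hypercubeFace] at this
    · obtain ⟨y, hy, hyx⟩ := List.mem_map.1 hx
      rwa [← hypercubeFace_injective i (!p) hyx]

/-- Any two distinct vertices of the hypercube are joined by paths of all lengths allowed by
distance, parity, and the number of vertices. -/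
def HypercubeBipanconnected (n : ℕ) : Prop :=
  ∀ (a b : Fin n → Bool) (l : ℕ), a ≠ b → hammingDist a b ≤ l →
    l % 2 = hammingDist a b % 2 → l < 2 ^ n →
      ∃ P : (hypercubeGraph n).Walk a b, P.IsPath ∧ P.length = l

/-- The avoided vertex is the neighbour of the start across bit `i`, so an edge can be put in front
of the path, or a cycle closed through that vertex. -/
theorem HypercubeBipanconnected.exists_isPath_of_flip {n : ℕ} (H : HypercubeBipanconnected n)
    (i : Fin (n + 1)) (p : Bool) {a b : Fin n → Bool} {l : ℕ} (hab : a ≠ b)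
    (hd : hammingDist a b + 1 ≤ l) (hl : (l + 1) % 2 = hammingDist a b % 2)
    (hlt : l + 1 < 2 ^ (n + 1)) :
    ∃ R : (hypercubeGraph (n + 1)).Walk (i.insertNth (!p) a) (i.insertNth p b),
      R.IsPath ∧ R.length = l ∧ (i.insertNth p a : Fin (n + 1) → Bool) ∉ R.support := by
  suffices ∃ (c : Fin n → Bool) (P : (hypercubeGraph n).Walk a c)
      (Q : (hypercubeGraph n).Walk c b), P.IsPath ∧ Q.IsPath ∧ P.length + 1 + Q.length = l ∧
        a ∉ Q.support by
    obtain ⟨c, P, Q, hP, hQ, hl, ha⟩ := this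
    obtain ⟨q, rfl⟩ : ∃ q, p = !q := ⟨!p, by simp⟩
    rw [Bool.not_not]
    obtain ⟨R, hR, hRl, hRs⟩ := exists_isPath_across i q hP hQ
    exact ⟨R, hR, hRl.trans hl, fun h => ha (hRs _ h)⟩
  by_cases hs : l ≤ 2 ^ n
  · obtain ⟨P, hP, hPl⟩ := H a b (l - 1) hab (by omega) (by omega) (by omega)
    exact ⟨b, P, Walk.nil, hP, Walk.IsPath.nil, by simp; omega, by simpa using hab⟩
  have hdn := hammingDist_le a b
  have hn2 : n < 2 ^ n := Nat.lt_two_pow_self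
  have hpos : 0 < hammingDist a b := hammingDist_pos.2 hab
  have hpow : 2 ^ (n + 1) = 2 * 2 ^ n := by ring
  have heven : 2 ^ n % 2 = 0 := by
    rcases n with _ | n
    · omega
    · rw [pow_succ]; omega
  -- This is the greatest length of the right parity. Deleting the first vertex `a` leaves a path
  -- that avoids `a` and starts at a neighbour `c`; the opposite face supplies the remaining length
  -- from `a` to `c`.
  obtain ⟨P, hP, hPl⟩ := H a b (2 ^ n - 2 + hammingDist a b % 2) hab (by omega) (by omega)
    (by omega)
  cases P with
  | nil => exact absurd rfl hab
  | @cons _ c _ h P =>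
    rw [Walk.cons_isPath_iff] at hP
    rw [Walk.length_cons] at hPl
    have h1 := hammingDist_eq_one_of_adj h
    obtain ⟨Q, hQ, hQl⟩ := H a c (l - (P.length + 1)) h.ne (by omega) (by omega) (by omega)
    exact ⟨c, Q, P, hQ, hP.1, by omega, hP.2⟩

theorem HypercubeBipanconnected.succ {n : ℕ} (H : HypercubeBipanconnected n) :
    HypercubeBipanconnected (n + 1) := by
  intro x y l hxy hd hl hlt
  obtain ⟨p, a, rfl⟩ : ∃ p a, x = (0 : Fin (n + 1)).insertNth p a :=
    ⟨_, _, (Fin.insertNth_self_removeNth 0 x).symm⟩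
  obtain ⟨q, b, rfl⟩ : ∃ q b, y = (0 : Fin (n + 1)).insertNth q b :=
    ⟨_, _, (Fin.insertNth_self_removeNth 0 y).symm⟩
  rw [hammingDist_insertNth] at hd hl
  have hdn := hammingDist_le a b
  have hn2 : n < 2 ^ n := Nat.lt_two_pow_self
  have hpow : 2 ^ (n + 1) = 2 * 2 ^ n := by ring
  have heven : n = 0 ∨ 2 ^ n % 2 = 0 := by
    rcases n with _ | n
    · exact Or.inl rfl
    · rw [pow_succ]; omega
  by_cases hpq : p = q
  · subst hpq
    have hab : a ≠ b := fun h => hxy (by rw [h])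
    have hpos : 0 < hammingDist a b := hammingDist_pos.2 hab
    simp only [ne_eq, not_true_eq_false, if_false, zero_add] at hd hl
    by_cases hs : l < 2 ^ n
    · obtain ⟨P, hP, hPl⟩ := H a b l hab hd hl hs
      exact ⟨P.map (hypercubeFace 0 p), hP.map (hypercubeFace_injective 0 p),
        (Walk.length_map _ _).trans hPl⟩
    · obtain ⟨R, hR, hRl, hRs⟩ := H.exists_isPath_of_flip 0 p (l := l - 1) hab (by omega)
        (by omega) (by omega)
      exact ⟨Walk.cons (hypercubeGraph_adj_insertNth_not 0 p a) R, hR.cons hRs,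
        by rw [Walk.length_cons]; omega⟩
  · obtain rfl : q = !p := by cases p <;> cases q <;> simp_all
    rw [if_pos hpq] at hd hl
    suffices ∃ (c : Fin n → Bool) (P : (hypercubeGraph n).Walk a c)
        (Q : (hypercubeGraph n).Walk c b), P.IsPath ∧ Q.IsPath ∧ P.length + 1 + Q.length = l by
      obtain ⟨c, P, Q, hP, hQ, hl⟩ := this
      obtain ⟨R, hR, hRl, -⟩ := exists_isPath_across 0 p hP hQ
      exact ⟨R, hR, hRl.trans hl⟩
    by_cases hab : a = b
    · subst hab
      rw [hammingDist_self] at hd hl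
      by_cases h1 : l = 1
      · exact ⟨a, Walk.nil, Walk.nil, Walk.IsPath.nil, Walk.IsPath.nil, h1.symm⟩
      have hn : 0 < n := by
        rcases n with _ | n
        · simp at hlt; omega
        · omega
      have h := hypercubeGraph_adj_update a ⟨0, hn⟩
      have hd1 := hammingDist_eq_one_of_adj h
      have hd2 := hammingDist_eq_one_of_adj h.symm
      -- Both lengths are odd: out to a neighbour in one face, back in the other.
      obtain ⟨P, hP, hPl⟩ := H _ _ (min (l - 2) (2 ^ n - 1)) h.ne (by omega) (by omega) (by omega)
      obtain ⟨Q, hQ, hQl⟩ := H _ _ (l - 1 - min (l - 2) (2 ^ n - 1)) h.symm.ne (by omega)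
        (by omega) (by omega)
      exact ⟨_, P, Q, hP, hQ, by omega⟩
    · have hpos : 0 < hammingDist a b := hammingDist_pos.2 hab
      by_cases hs : l ≤ 2 ^ n
      · obtain ⟨P, hP, hPl⟩ := H a b (l - 1) hab (by omega) (by omega) (by omega)
        exact ⟨b, P, Walk.nil, hP, Walk.IsPath.nil, by simp; omega⟩
      -- For `n = 1`, `l` would be even with `2 < l < 4`.
      have hn : 2 ≤ n := by
        by_contra hn
        obtain rfl : n = 1 := by omega
        omega
      obtain ⟨c, hc, hac⟩ := exists_adj_ne hn a b
      have h1 := hammingDist_eq_one_of_adj hc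
      have h2 := hammingDist_mod_two a c b
      have h3 := hammingDist_le a c
      -- Again the greatest length of the right parity, since `c` and `b` have opposite parities.
      obtain ⟨P, hP, hPl⟩ := H a c (2 ^ n - 1 - hammingDist a b % 2) hac (by omega) (by omega)
        (by omega)
      obtain ⟨Q, hQ, hQl⟩ := H c b (l - 1 - (2 ^ n - 1 - hammingDist a b % 2)) hc.ne (by omega)
        (by omega) (by omega)
      exact ⟨c, P, Q, hP, hQ, by omega⟩

theorem hypercubeBipanconnected (n : ℕ) : HypercubeBipanconnected n := by
  induction n with
  | zero => exact fun a b _ h => absurd (Subsingleton.elim a b) h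
  | succ n ih => exact ih.succ

section EnhancedHypercube

variable {n k : ℕ}

theorem LiesOnCycleOfLength.of_isPath {V : Type*} {G : SimpleGraph V} {u v : V} (h : G.Adj u v)
    {p : G.Walk v u} (hp : p.IsPath) (hl : 2 ≤ p.length) :
    LiesOnCycleOfLength G s(u, v) (p.length + 1) := by
  refine ⟨u, Walk.cons h p, (Walk.cons_isCycle_iff p h).2 ⟨hp, fun hmem => ?_⟩, by simp, by simp⟩
  have := hp.length_eq_one_of_mem_edges (Sym2.eq_swap ▸ hmem)
  omega

theorem LiesOnCycleOfLength.map {V W : Type*} {G : SimpleGraph V} {G' : SimpleGraph W}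
    (f : G →g G') (hf : Function.Injective f) {e : Sym2 V} {l : ℕ}
    (h : LiesOnCycleOfLength G e l) : LiesOnCycleOfLength G' (e.map f) l := by
  obtain ⟨u, p, hp, hl, he⟩ := h
  exact ⟨f u, p.map f, hp.map hf, by simpa using hl, by
    rw [Walk.edges_map]; exact List.mem_map_of_mem he⟩

/-! ### Skips and the swapping automorphism -/

/-- The vertex at the other end of the skip at `u`. -/
def skipNeighbor (k : ℕ) (u : Fin n → Bool) : Fin n → Bool :=
  fun i => u i ^^ decide (i.val < k)

theorem skipGraph_adj_iff (hk : 1 ≤ k) (hkn : k ≤ n) {u v : Fin n → Bool} :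
    (skipGraph n k).Adj u v ↔ ∀ i : Fin n, u i ≠ v i ↔ i.val < k := by
  refine ⟨fun h => h.2, fun h => ⟨fun huv => ?_, h⟩⟩
  exact (h ⟨0, by omega⟩).2 hk (congrFun huv _)

theorem card_filter_val_lt (hkn : k ≤ n) :
    (Finset.univ.filter fun i : Fin n => i.val < k).card = k := by
  rw [Fin.card_filter_val_lt, min_eq_right hkn]

theorem hammingDist_of_skip (hkn : k ≤ n) {u v : Fin n → Bool}
    (h : (skipGraph n k).Adj u v) : hammingDist u v = k := by
  rw [hammingDist, Finset.filter_congr fun i _ => h.2 i]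
  exact card_filter_val_lt hkn

/-- The linear automorphism of the enhanced hypercube which exchanges the direction of the bit `j`
with the direction of the skips. -/
def skipSwap (hk : 1 ≤ k) (hkn : k ≤ n) (j : Fin n) (hj : j.val < k) :
    enhancedHypercube n k →g enhancedHypercube n k where
  -- Bit `j` is added to the other bits below `k`: the unit vector of `j` and the skip vector are
  -- exchanged, and the other unit vectors are fixed.
  toFun u i := u i ^^ (u j && decide (i.val < k ∧ i ≠ j))
  map_rel' := by
    intro u v h
    rw [enhancedHypercube, sup_adj, skipGraph_adj_iff hk hkn] at h ⊢
    rcases h with ⟨i, hi, huniq⟩ | h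
    · by_cases hij : i = j
      · subst hij
        refine Or.inr fun m => ?_
        by_cases hm : m = i
        · subst hm; simpa [hj] using hi
        · have := mt (huniq m) hm
          by_cases hmk : m.val < k
          all_goals
            simp only [not_not] at this
            revert hi
            simp [this, hm, hmk]
      · refine Or.inl ⟨i, ?_, fun m hm => ?_⟩
        · have := mt (huniq j) (Ne.symm hij)
          simp only [not_not] at this
          simpa [this] using hi
        · have := mt (huniq j) (Ne.symm hij)
          simp only [not_not] at this
          exact huniq m (by simpa [this] using hm)
    · refine Or.inl ⟨j, by simpa using (h j).2 hj, fun m hm => ?_⟩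
      by_contra hmj
      have h1 := h m
      have h2 := (h j).2 hj
      revert hm h1 h2
      by_cases hmk : m.val < k <;> simp only [hmk] <;>
        cases u m <;> cases v m <;> cases u j <;> cases v j <;> simp [hmj]

theorem skipSwap_involutive (hk : 1 ≤ k) (hkn : k ≤ n) (j : Fin n) (hj : j.val < k) :
    Function.Involutive (skipSwap hk hkn j hj) := by
  intro u
  funext i
  simp [skipSwap]

theorem LiesOnCycleOfLength.of_skipSwap (hk : 1 ≤ k) (hkn : k ≤ n) (j : Fin n) (hj : j.val < k)
    {u v : Fin n → Bool} {l : ℕ}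
    (h : LiesOnCycleOfLength (enhancedHypercube n k)
      s(skipSwap hk hkn j hj u, skipSwap hk hkn j hj v) l) :
    LiesOnCycleOfLength (enhancedHypercube n k) s(u, v) l := by
  have := h.map (skipSwap hk hkn j hj) (skipSwap_involutive hk hkn j hj).injective
  simpa only [Sym2.map_mk, (skipSwap_involutive hk hkn j hj) u,
    (skipSwap_involutive hk hkn j hj) v] using this

theorem skipSwap_adj_of_skip (hk : 1 ≤ k) (hkn : k ≤ n) (j : Fin n) (hj : j.val < k)
    {u v : Fin n → Bool} (h : (skipGraph n k).Adj u v) :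
    (hypercubeGraph n).Adj (skipSwap hk hkn j hj u) (skipSwap hk hkn j hj v) := by
  rw [skipGraph_adj_iff hk hkn] at h
  refine ⟨j, by simpa [skipSwap] using (h j).2 hj, fun m hm => ?_⟩
  by_contra hmj
  have h1 := h m
  have h2 := (h j).2 hj
  revert hm h1 h2
  by_cases hmk : m.val < k <;> simp only [skipSwap, RelHom.coeFn_mk, hmk] <;>
    cases u m <;> cases v m <;> cases u j <;> cases v j <;> simp [hmj]

theorem skipSwap_adj_of_bit (hk : 1 ≤ k) (hkn : k ≤ n) (j : Fin n) (hj : j.val < k)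
    {u v : Fin n → Bool} (h : u j ≠ v j) (huniq : ∀ m, u m ≠ v m → m = j) :
    (skipGraph n k).Adj (skipSwap hk hkn j hj u) (skipSwap hk hkn j hj v) := by
  rw [skipGraph_adj_iff hk hkn]
  intro m
  by_cases hm : m = j
  · subst hm; simpa [hj, skipSwap] using h
  · have := mt (huniq m) hm
    simp only [not_not] at this
    revert h
    by_cases hmk : m.val < k <;> simp [skipSwap, this, hm, hmk]

/-! ### Cycles through each kind of edge -/

theorem liesOnCycle_of_hypercubeGraph_adj {u v : Fin n → Bool} (h : (hypercubeGraph n).Adj u v)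
    {l : ℕ} (hl : Even l) (h4 : 4 ≤ l) (hln : l ≤ 2 ^ n) :
    LiesOnCycleOfLength (enhancedHypercube n k) s(u, v) l := by
  have hd := hammingDist_eq_one_of_adj h.symm
  rw [Nat.even_iff] at hl
  obtain ⟨P, hP, hPl⟩ := hypercubeBipanconnected n v u (l - 1) h.symm.ne (by omega) (by omega)
    (by omega)
  have hle : hypercubeGraph n ≤ enhancedHypercube n k := le_sup_left
  convert LiesOnCycleOfLength.of_isPath (hle h) (hP.mapLe hle) (by simp; omega) using 1
  simp; omega

theorem liesOnCycle_of_skipGraph_adj (hk : 1 ≤ k) (hkn : k ≤ n) (hke : Even k)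
    {u v : Fin n → Bool} (h : (skipGraph n k).Adj u v)
    {l : ℕ} (hl : Odd l) (hkl : k + 1 ≤ l) (hln : l ≤ 2 ^ n) :
    LiesOnCycleOfLength (enhancedHypercube n k) s(u, v) l := by
  have hd := hammingDist_of_skip hkn h.symm
  rw [Nat.odd_iff] at hl
  rw [Nat.even_iff] at hke
  obtain ⟨P, hP, hPl⟩ := hypercubeBipanconnected n v u (l - 1) h.symm.ne (by omega) (by omega)
    (by omega)
  have hle : hypercubeGraph n ≤ enhancedHypercube n k := le_sup_left
  have hle' : skipGraph n k ≤ enhancedHypercube n k := le_sup_right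
  convert LiesOnCycleOfLength.of_isPath (hle' h) (hP.mapLe hle) (by simp; omega) using 1
  simp; omega

/-- The cycle goes from `u` to `v`, along a hypercube path avoiding `u` to the skip neighbour of
`u`, and back by the skip. The path has length `l - 2`, at least `k + 1` because its ends differ in
`k` low bits and in bit `i`. -/
theorem liesOnCycle_of_high_bit (hk : 1 ≤ k) (hke : Even k) {i : Fin n}
    (hi : k ≤ i.val) {u v : Fin n → Bool} (h : u i ≠ v i) (huniq : ∀ m, u m ≠ v m → m = i)
    {l : ℕ} (hl : Odd l) (hkl : k + 3 ≤ l) (hln : l ≤ 2 ^ n) :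
    LiesOnCycleOfLength (enhancedHypercube n k) s(u, v) l := by
  have hle : hypercubeGraph n ≤ enhancedHypercube n k := le_sup_left
  have hle' : skipGraph n k ≤ enhancedHypercube n k := le_sup_right
  have huv : (hypercubeGraph n).Adj u v := ⟨i, h, huniq⟩
  have hkn : k ≤ n := by omega
  have hadj : (skipGraph n k).Adj u (skipNeighbor k u) :=
    (skipGraph_adj_iff hk hkn).2 fun m => by
      by_cases hm : m.val < k <;> simp [skipNeighbor, hm]
  have hdist := hammingDist_of_skip hkn hadj
  have hwi : skipNeighbor k u i = u i := by simp [skipNeighbor, not_lt.2 hi]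
  generalize skipNeighbor k u = w at hadj hdist hwi
  obtain _ | n := n
  · exact i.elim0
  obtain ⟨p, a, rfl⟩ : ∃ p a, u = i.insertNth p a :=
    ⟨_, _, (Fin.insertNth_self_removeNth i u).symm⟩
  obtain ⟨q, b, rfl⟩ : ∃ q b, w = i.insertNth q b :=
    ⟨_, _, (Fin.insertNth_self_removeNth i w).symm⟩
  obtain rfl : v = i.insertNth (!p) a := by
    funext m
    induction m using Fin.succAboveCases i with
    | x => simp only [Fin.insertNth_apply_same] at h ⊢; revert h; cases p <;> cases v i <;> simp
    | p m =>
      have := mt (huniq (i.succAbove m)) (Fin.succAbove_ne i m)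
      simpa [eq_comm] using this
  obtain rfl : q = p := by simpa using hwi
  rw [hammingDist_insertNth, if_neg (by simp), zero_add] at hdist
  have hab : a ≠ b := hammingDist_pos.1 (by omega)
  rw [Nat.odd_iff] at hl
  rw [Nat.even_iff] at hke
  have hpow : 2 ^ (n + 1) = 2 * 2 ^ n := by ring
  obtain ⟨R, hR, hRl, hRs⟩ := (hypercubeBipanconnected n).exists_isPath_of_flip i q (l := l - 2)
    hab (by omega) (by omega) (by omega)
  have hR' : ((R.mapLe hle).concat (hle' hadj).symm).IsPath :=
    (hR.mapLe hle).concat (by simpa using hRs) _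
  convert LiesOnCycleOfLength.of_isPath (hle huv) hR' (by simp; omega) using 1
  simp; omega

/-! ### Lower bound for odd cycles -/

/-- `c i` counts the steps taken as flips of bit `i`, and `t` those taken as skips. -/
theorem exists_bit_counts (hk : 1 ≤ k) (hkn : k ≤ n) {u v : Fin n → Bool}
    (p : (enhancedHypercube n k).Walk u v) :
    ∃ (c : Fin n → ℕ) (t : ℕ), ∑ i, c i + t = p.length ∧
      ∀ i, u i ≠ v i ↔ (c i + if i.val < k then t else 0) % 2 = 1 := by
  induction p with
  | nil => exact ⟨0, 0, by simp, by simp⟩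
  | @cons u w v h p ih =>
    obtain ⟨c, t, hsum, hc⟩ := ih
    simp only [enhancedHypercube, sup_adj, skipGraph_adj_iff hk hkn] at h
    have hne : ∀ i, u i ≠ v i ↔ ¬(u i ≠ w i ↔ w i ≠ v i) := fun i => by
      cases u i <;> cases w i <;> cases v i <;> simp
    rcases h with ⟨j, hj, huniq⟩ | h
    · refine ⟨fun i => c i + if i = j then 1 else 0, t, ?_, fun i => ?_⟩
      · rw [Finset.sum_add_distrib, Walk.length_cons, ← hsum]
        simp; omega
      · have hi : u i ≠ w i ↔ i = j := ⟨huniq i, fun h => h ▸ hj⟩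
        rw [hne, hc, hi]
        by_cases hij : i = j <;> simp only [hij, if_true, if_false, true_iff, false_iff] <;>
          split_ifs <;> omega
    · refine ⟨c, t + 1, by rw [Walk.length_cons, ← hsum]; omega, fun i => ?_⟩
      rw [hne, hc, h]
      by_cases hik : i.val < k <;> simp only [hik, if_true, if_false, true_iff, false_iff] <;> omega

theorem le_length_of_odd_closed_walk (hk : 1 ≤ k) (hkn : k ≤ n) {u : Fin n → Bool}
    (p : (enhancedHypercube n k).Walk u u) (hp : Odd p.length) : k + 1 ≤ p.length := by
  obtain ⟨c, t, hsum, hc⟩ := exists_bit_counts hk hkn p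
  simp only [ne_eq, not_true_eq_false, false_iff, Nat.mod_two_not_eq_one] at hc
  rw [Nat.odd_iff] at hp
  -- If `t` were even, every `c i` and hence the length would be even. With `t` odd, each of the `k`
  -- low bits needs an odd number of flips, besides at least one skip.
  have ht : t % 2 = 1 := by
    by_contra ht
    have : 2 ∣ ∑ i, c i := Finset.dvd_sum fun i _ => by
      have := hc i
      split_ifs at this <;> omega
    omega
  have hle : ∑ i : Fin n, (if i.val < k then 1 else 0) ≤ ∑ i, c i :=
    Finset.sum_le_sum fun i _ => by
      have := hc i
      split_ifs at this ⊢ <;> omega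
  have hcard : ∑ i : Fin n, (if i.val < k then 1 else 0) = k := by
    rw [← Finset.card_filter]
    exact card_filter_val_lt hkn
  omega

end EnhancedHypercube

theorem mainTheorem1 (n k : ℕ) (hk : 1 ≤ k) (hkn : k ≤ n) :
    (3 ≤ n → ∀ e ∈ (enhancedHypercube n k).edgeSet, ∀ l : ℕ,
      Even l → 4 ≤ l → l ≤ 2 ^ n → LiesOnCycleOfLength (enhancedHypercube n k) e l) ∧
    (Even k →
      (∀ e ∈ (enhancedHypercube n k).edgeSet, ∀ l : ℕ,
        Odd l → k + 3 ≤ l → l ≤ 2 ^ n - 1 →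
          LiesOnCycleOfLength (enhancedHypercube n k) e l) ∧
      (∀ e ∈ (enhancedHypercube n k).edgeSet,
        (∀ i : Fin n, k + 1 ≤ i.val + 1 → e ∉ dimensionEdges n i) →
          LiesOnCycleOfLength (enhancedHypercube n k) e (k + 1)) ∧
      (∀ (u : Fin n → Bool) (p : (enhancedHypercube n k).Walk u u),
        p.IsCycle → Odd p.length → k + 1 ≤ p.length)) := by
  refine ⟨fun _ e => ?_, fun hke => ⟨fun e => ?_, fun e => ?_, fun u p _ hp =>
    le_length_of_odd_closed_walk hk hkn p hp⟩⟩ <;> induction e using Sym2.ind with | _ u v => ?_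
  · rintro (h | h) l hl h4 hln
    · exact liesOnCycle_of_hypercubeGraph_adj h hl h4 hln
    · exact .of_skipSwap hk hkn ⟨0, by omega⟩ hk
        (liesOnCycle_of_hypercubeGraph_adj (skipSwap_adj_of_skip hk hkn ⟨0, by omega⟩ hk h) hl h4 hln)
  · rintro (⟨i, hi, huniq⟩ | h) l hl hkl hln
    · by_cases hik : i.val < k
      · exact .of_skipSwap hk hkn i hik (liesOnCycle_of_skipGraph_adj hk hkn hke
          (skipSwap_adj_of_bit hk hkn i hik hi huniq) hl (by omega) (by omega))
      · exact liesOnCycle_of_high_bit hk hke (not_lt.1 hik) hi huniq hl hkl (by omega)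
    · exact liesOnCycle_of_skipGraph_adj hk hkn hke h hl (by omega) (by omega)
  · have hkn' : k + 1 ≤ 2 ^ n := lt_of_le_of_lt hkn Nat.lt_two_pow_self
    rintro (⟨i, hi, huniq⟩ | h) hE
    · by_cases hik : i.val < k
      · exact .of_skipSwap hk hkn i hik (liesOnCycle_of_skipGraph_adj hk hkn hke
          (skipSwap_adj_of_bit hk hkn i hik hi huniq) hke.add_one le_rfl hkn')
      -- An edge in a bit `i ≥ k` is excluded by `hE`.
      · refine absurd ⟨u, ?_⟩ (hE i (by omega))
        congr
        funext m
        by_cases hm : m = i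
        · subst hm
          rw [Function.update_self]
          have hi' : u m ≠ v m := hi
          revert hi'
          cases u m <;> cases v m <;> simp
        · rw [Function.update_of_ne hm]
          exact (not_not.1 (mt (huniq m) hm)).symm
    · exact liesOnCycle_of_skipGraph_adj hk hkn hke h hke.add_one le_rfl hkn'
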